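/- **Theorem 1.3 (Restricting primitive homology).** Let $f\colon Y\to X$ be a normal covering of finite connected graphs with (finite) deck group $G$, let $y_0$ be a vertex of $Y$ and $x_0=f(y_0)$. Identify $\pi_1(X,x_0)$ with the free group $F_n$, where $n\ge 2$ is its rank, and let $\varphi\colon F_n\to G$ be the homomorphism that defines the cover: the lift at $y_0$ of a loop $\gamma$ at $x_0$ ends at $\varphi(\gamma)\cdot y_0$. An element of a free group is *primitive* if it is part of a free basis. An *elevation* of a loop $\gamma$ at $x_0$ is a closed lift to $Y$, at any point over $x_0$, of the smallest positive power of $\gamma$ that has a closed lift there. Let the *primitive homology* $H_1^{\mathrm{prim}}(Y;\mathbb C)\subseteq H_1(Y;\mathbb C)$ be the complex span of the homology classes of all elevations of loops that represent primitive elements of $\pi_1(X,x_0)$. Let $\mathrm{Irr}(G)$ be the set of isomorphism classes of irreducible complex representations of $G$, and let $\mathrm{Irr}^{\mathrm{pr}}(\varphi,G)\subseteq\mathrm{Irr}(G)$ consist of those $V$ for which $\varphi(\gamma)v=v$ for some primitive $\gamma\in F_n$ and some nonzero $v\in V$. Then there is an isomorphism of $G$-representations $$H_1(Y;\mathbb C)\;\cong\;\bigoplus_{V\in\mathrm{Irr}(G)}V^{(n-1)\dim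 V}\;\oplus\;\mathbb C_{\mathrm{triv}},$$ and every such isomorphism maps $H_1^{\mathrm{prim}}(Y;\mathbb C)$ into $$\bigoplus_{V\in\mathrm{Irr}^{\mathrm{pr}}(\varphi,G)}V^{(n-1)\dim V}\;\oplus\;\mathbb C_{\mathrm{triv}}.$$ In other words, an irreducible complex representation $V$ of $G$ is isomorphic to a subrepresentation of $H_1(Y;\mathbb C)$ contained in $H_1^{\mathrm{prim}}(Y;\mathbb C)$ only if $\varphi(\gamma)v=v$ for some primitive $\gamma\in F_n$ and some nonzero $v\in V$. -/

import Mathlib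

/-- A graph (one-dimensional CW complex) with vertex set `V` and edge set `E`.  Every edge carries
an orientation (its characteristic map); loops and multiple edges are allowed. -/
structure OrientedGraph (V E : Type*) where
  /-- the initial vertex of an edge -/
  src : E → V
  /-- the terminal vertex of an edge -/
  tgt : E → V

namespace OrientedGraph

variable {V E VX EX VY EY : Type*}

/-- The initial vertex of an oriented edge: `(e, true)` is `e` with its given orientation and
`(e, false)` is `e` with the opposite orientation. -/
def dartSrc (X : OrientedGraph V E) (d : E × Bool) : V :=
  if d.2 then X.src d.1 else X.tgt d.1

/-- The terminal vertex of an oriented edge. -/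
def dartTgt (X : OrientedGraph V E) (d : E × Bool) : V :=
  if d.2 then X.tgt d.1 else X.src d.1

/-- `X.IsWalk a L b`: the list `L` of oriented edges is an edge path from `a` to `b`. -/
def IsWalk (X : OrientedGraph V E) : V → List (E × Bool) → V → Prop
  | a, [], b => a = b
  | a, d :: L, b => X.dartSrc d = a ∧ X.IsWalk (X.dartTgt d) L b

/-- A graph is connected if it is nonempty and any two vertices are joined by an edge path. -/
def Connected (X : OrientedGraph V E) : Prop :=
  Nonempty V ∧ ∀ a b : V, ∃ L, X.IsWalk a L b

theorem IsWalk.append {X : OrientedGraph V E} {L M : List (E × Bool)} {a b c : V}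
    (hL : X.IsWalk a L b) (hM : X.IsWalk b M c) : X.IsWalk a (L ++ M) c := by
  induction L generalizing a with
  | nil => cases hL; exact hM
  | cons d L ih => exact ⟨hL.1, ih hL.2⟩

theorem IsWalk.split {X : OrientedGraph V E} {L M : List (E × Bool)} {a c : V}
    (h : X.IsWalk a (L ++ M) c) : ∃ b, X.IsWalk a L b ∧ X.IsWalk b M c := by
  induction L generalizing a with
  | nil => exact ⟨a, rfl, h⟩
  | cons d L ih =>
    obtain ⟨b, hb, hb'⟩ := ih h.2
    exact ⟨b, ⟨h.1, hb⟩, hb'⟩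

theorem IsWalk.invRev {X : OrientedGraph V E} {L : List (E × Bool)} {a b : V}
    (hL : X.IsWalk a L b) : X.IsWalk b (FreeGroup.invRev L) a := by
  induction L generalizing a with
  | nil => cases hL; rfl
  | cons d L ih =>
    have h1 := ih hL.2
    have h2 : FreeGroup.invRev (d :: L) = FreeGroup.invRev L ++ [(d.1, !d.2)] := by
      simp [FreeGroup.invRev]
    rw [h2]
    refine h1.append ⟨?_, ?_⟩
    · cases hd : d.2 <;> simp [dartSrc, dartTgt, hd]
    · rw [← hL.1]
      cases hd : d.2 <;> simp [dartSrc, dartTgt, hd, IsWalk]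

/-- Deleting a backtrack from an edge path leaves an edge path with the same end points. -/
theorem IsWalk.step {X : OrientedGraph V E} {L M : List (E × Bool)} {a b : V}
    (hL : X.IsWalk a L b) (h : FreeGroup.Red.Step L M) : X.IsWalk a M b := by
  cases h with
  | @not L₁ L₂ e s =>
    obtain ⟨c, h1, h2⟩ := hL.split
    refine h1.append ?_
    obtain ⟨hc, -, h3⟩ := h2
    have : X.dartTgt (e, !s) = c := by
      rw [← hc]; cases s <;> simp [dartSrc, dartTgt]
    rwa [this] at h3

/-- The fundamental group of a graph at the vertex `a`, as the edge path group: homotopy classes of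
closed edge paths at `a`, with concatenation.  Two edge paths are homotopic when they are related by
insertions and deletions of backtracks `e e⁻¹`, that is, when they define the same element of the
free group on the edges (by `IsWalk.step` the reduced words of edge paths are edge paths, so that
the homotopy can be taken through edge paths). -/
def pi1 (X : OrientedGraph V E) (a : V) : Subgroup (FreeGroup E) where
  carrier := {w | ∃ L, X.IsWalk a L a ∧ FreeGroup.mk L = w}
  one_mem' := ⟨[], rfl, rfl⟩
  mul_mem' := by
    rintro _ _ ⟨L, hL, rfl⟩ ⟨M, hM, rfl⟩
    exact ⟨L ++ M, hL.append hM, FreeGroup.mul_mk.symm⟩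
  inv_mem' := by
    rintro _ ⟨L, hL, rfl⟩
    exact ⟨FreeGroup.invRev L, hL.invRev, FreeGroup.inv_mk.symm⟩

/-- The cellular boundary map `∂ e = tgt e - src e` with complex coefficients. -/
noncomputable def boundary (X : OrientedGraph V E) : (E →₀ ℂ) →ₗ[ℂ] (V →₀ ℂ) :=
  Finsupp.lmapDomain ℂ ℂ X.tgt - Finsupp.lmapDomain ℂ ℂ X.src

/-- The first homology `H₁(X; ℂ)`: there are no cells of dimension two, so it consists of the
cellular one-cycles. -/
noncomputable def H1 (X : OrientedGraph V E) : Submodule ℂ (E →₀ ℂ) :=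
  LinearMap.ker X.boundary

/-- The cellular one-chain of an edge path. -/
noncomputable def chain (L : List (E × Bool)) : E →₀ ℂ :=
  (L.map fun d => Finsupp.single d.1 (if d.2 then (1 : ℂ) else -1)).sum

/-- The image of an edge path under a map of edges that preserves the orientations. -/
def mapPath (fE : EY → EX) (L : List (EY × Bool)) : List (EX × Bool) :=
  L.map fun d => (fE d.1, d.2)

/-- `(fV, fE)` is a covering map of graphs `Y → X`: an orientation preserving morphism that
restricts to a bijection from the edge ends at `y` to the edge ends at `fV y`, for each vertex `y`.
(For every covering space of a graph, the lifted cell structure with the lifted orientations is of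
this form.) -/
structure IsCovering (Y : OrientedGraph VY EY) (X : OrientedGraph VX EX)
    (fV : VY → VX) (fE : EY → EX) : Prop where
  map_src : ∀ e, X.src (fE e) = fV (Y.src e)
  map_tgt : ∀ e, X.tgt (fE e) = fV (Y.tgt e)
  lift_src : ∀ y e, X.src e = fV y → ∃! e', Y.src e' = y ∧ fE e' = e
  lift_tgt : ∀ y e, X.tgt e = fV y → ∃! e', Y.tgt e' = y ∧ fE e' = e

/-- `Y → X` is a normal `G`-cover: a covering map of connected graphs together with an action of `G`
on `Y` by deck transformations which is simply transitive on the fibres.  (As `Y` is connected, this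
means that the cover is normal and that the action identifies `G` with its deck group.) -/
structure IsNormalCover (G : Type*) [Group G] [MulAction G VY] [MulAction G EY]
    (Y : OrientedGraph VY EY) (X : OrientedGraph VX EX) (fV : VY → VX) (fE : EY → EX) : Prop where
  covering : IsCovering Y X fV fE
  connected_base : X.Connected
  connected_total : Y.Connected
  src_smul : ∀ (g : G) (e : EY), Y.src (g • e) = g • Y.src e
  tgt_smul : ∀ (g : G) (e : EY), Y.tgt (g • e) = g • Y.tgt e
  map_smul_vertex : ∀ (g : G) (y : VY), fV (g • y) = fV y
  map_smul_edge : ∀ (g : G) (e : EY), fE (g • e) = fE e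
  simply_transitive : ∀ y y' : VY, fV y = fV y' → ∃! g : G, g • y = y'

/-- The cover `Y → X` is the one given by the homomorphism `φ : F → G`, where `F` is identified with
the fundamental group of `X` at the image of the base point `y₀` through `e`: the lift to `Y`
starting at `y₀` of each closed edge path that represents `w` ends at `φ w • y₀`. -/
def IsGivenBy {F G : Type*} [Group F] [Group G] [MulAction G VY] (Y : OrientedGraph VY EY)
    (X : OrientedGraph VX EX) (fV : VY → VX) (fE : EY → EX) (y₀ : VY)
    (e : F ≃* X.pi1 (fV y₀)) (φ : F →* G) : Prop :=
  ∀ (w : F) (L : List (EY × Bool)) (y : VY), Y.IsWalk y₀ L y →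
    FreeGroup.mk (mapPath fE L) = (e w : FreeGroup EX) → fV y = fV y₀ → y = φ w • y₀

/-- The action of `G` on the cellular one-chains of a graph with edge set `E`. -/
noncomputable def chainRep (G E : Type*) [Group G] [MulAction G E] :
    Representation ℂ G (E →₀ ℂ) where
  toFun g := Finsupp.lmapDomain ℂ ℂ (fun e => g • e)
  map_one' := by
    refine Finsupp.lhom_ext fun e c => ?_
    simp
  map_mul' g h := by
    refine Finsupp.lhom_ext fun e c => ?_
    simp [mul_smul]

section

variable {G : Type*} [Group G] [MulAction G VY] [MulAction G EY]
  {Y : OrientedGraph VY EY} {X : OrientedGraph VX EX} {fV : VY → VX} {fE : EY → EX}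

theorem IsNormalCover.H1_le_comap (h : IsNormalCover G Y X fV fE) (g : G) :
    Y.H1 ≤ Y.H1.comap (chainRep G EY g) := by
  intro c hc
  have key : Y.boundary ∘ₗ chainRep G EY g
      = Finsupp.lmapDomain ℂ ℂ (fun v => g • v) ∘ₗ Y.boundary := by
    refine Finsupp.lhom_ext fun e c => ?_
    simp [boundary, chainRep, h.src_smul, h.tgt_smul, map_sub, Finsupp.mapDomain_single]
  have hc' : Y.boundary c = 0 := hc
  change Y.boundary (chainRep G EY g c) = 0
  have := LinearMap.congr_fun key c
  simpa [hc'] using this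

/-- The representation of the deck group `G` on `H₁(Y; ℂ)`. -/
noncomputable def IsNormalCover.homologyRep (h : IsNormalCover G Y X fV fE) :
    Representation ℂ G Y.H1 :=
  (chainRep G EY).subrepresentation Y.H1 h.H1_le_comap

end

end OrientedGraph

/-- An element of a free group is primitive if it belongs to a free basis. -/
def IsPrimitiveElement {F : Type*} [Group F] (γ : F) : Prop :=
  ∃ (S : Set F) (b : FreeGroupBasis S F), (∀ s : S, b s = s) ∧ γ ∈ S

namespace OrientedGraph

variable {VX EX VY EY : Type*}

/-- `L` is an elevation at the vertex `y` of the closed edge path `l`: a closed edge path at `y`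
which lifts the power `l ^ k`, where `k` is the smallest positive integer such that the lift of `l ^ k`
at `y` is closed. -/
def IsElevation (Y : OrientedGraph VY EY) (fE : EY → EX) (l : List (EX × Bool)) (y : VY)
    (L : List (EY × Bool)) : Prop :=
  ∃ k : ℕ, 0 < k ∧ Y.IsWalk y L y ∧ mapPath fE L = (List.replicate k l).flatten ∧
    ∀ (j : ℕ) (M : List (EY × Bool)), 0 < j → j < k →
      mapPath fE M = (List.replicate j l).flatten → ¬ Y.IsWalk y M y

/-- The primitive homology `H₁^prim(Y; ℂ)`: the complex span of the homology classes of all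
elevations to `Y` of closed edge paths at `x₀` that represent primitive elements of the fundamental
group of `X` at `x₀`. -/
noncomputable def primitiveH1 (Y : OrientedGraph VY EY) (X : OrientedGraph VX EX)
    (fV : VY → VX) (fE : EY → EX) (x₀ : VX) : Submodule ℂ Y.H1 :=
  Submodule.span ℂ {c | ∃ (γ : X.pi1 x₀) (l : List (EX × Bool)) (y : VY) (L : List (EY × Bool)),
    IsPrimitiveElement γ ∧ X.IsWalk x₀ l x₀ ∧ FreeGroup.mk l = (γ : FreeGroup EX) ∧
    fV y = x₀ ∧ Y.IsElevation fE l y L ∧ (c : EY →₀ ℂ) = chain L}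

end OrientedGraph

/-- The condition that defines `Irr^pr(φ, G)`: the representation `ρ` of `G` is irreducible, and the
image under `φ` of some primitive element fixes a nonzero vector. -/
def IsIrrPr {F G U : Type*} [Group F] [Group G] [AddCommGroup U] [Module ℂ U] (φ : F →* G)
    (ρ : Representation ℂ G U) : Prop :=
  ρ.IsIrreducible ∧ ∃ γ : F, IsPrimitiveElement γ ∧ ∃ v : U, v ≠ 0 ∧ ρ (φ γ) v = v

universe w

/-- The family `σ` is a complete list `Irr(G)` of the irreducible complex representations of `G`
without repetitions up to isomorphism. -/
structure IsCompleteIrrFamily {G ι : Type*} [Group G] {W : ι → Type w} [∀ i, AddCommGroup (W i)]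
    [∀ i, Module ℂ (W i)] (σ : ∀ i, Representation ℂ G (W i)) : Prop where
  irreducible : ∀ i, (σ i).IsIrreducible
  eq_of_equiv : ∀ i j, Nonempty ((σ i).Equiv (σ j)) → i = j
  complete : ∀ (U : Type w) [AddCommGroup U] [Module ℂ U] (ρ : Representation ℂ G U),
    ρ.IsIrreducible → ∃ i, Nonempty (ρ.Equiv (σ i))

/-- The representation `⨁_{V ∈ Irr(G)} V ^ ((n - 1) dim V) ⊕ ℂ`, for a family `σ` that lists the
irreducible representations. -/
noncomputable def chevalleyWeilRep {G ι : Type*} [Group G] {W : ι → Type w}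
    [∀ i, AddCommGroup (W i)] [∀ i, Module ℂ (W i)] (σ : ∀ i, Representation ℂ G (W i)) (n : ℕ) :=
  (Representation.directSum fun i =>
    (σ i).finsupp (Fin ((n - 1) * Module.finrank ℂ (W i)))).prod (Representation.trivial ℂ G ℂ)

/-!
Why the theorem holds.

*The homology as a representation.* Hom spaces into irreducible representations count
multiplicities, so a finite-dimensional representation `M` of the finite group `G` is determined by
the numbers `dim Hom_G(M, σ i)` (`IsCompleteIrrFamily.nonempty_equiv`, by splitting off simple
summands one at a time). By Maschke's theorem `Hom_G(-, S)` is exact; it is applied to the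
augmented cellular chain complex `0 → H₁(Y) → C₁(Y) → C₀(Y) → ℂ → 0`, which is exact because `Y` is
connected. As `G` acts simply transitively on the fibres over the vertices and over the edges of
`X`, the chain modules are free over `ℂ[G]`, with as many basis elements as `X` has edges and
vertices. Hence `dim Hom_G(H₁(Y), S) = (|E| - |V|) dim S + dim Hom_G(ℂ, S)`, and it remains to see
that `|E| - |V| = n - 1`. As `π₁(X)` is free of rank `n`, this follows from the exact sequence
`0 → ℂ → ℂ^V → ℂ^E → Hom(π₁(X), ℂ) → 0` (`Connected.card_edges_add_one`), where no spanning tree is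
needed: homomorphisms to an abelian group extend from closed paths to all paths by means of
auxiliary paths from the base point.

*The primitive homology.* Let `L` be an elevation at `y₀` of a primitive loop `γ`, say a closed lift
of `γ ^ k`. The translate of `L` by `φ γ` is the lift of `γ ^ k` at the end point `φ γ • y₀` of the
lift of `γ`. By uniqueness of lifts it is a cyclic rotation of `L`, so its chain is that of `L`: the
class of `L` is fixed by `φ γ`. Elevations at other points of the fibre are translates of such.
Therefore an equivariant map from `H₁(Y)` to a representation in which no `φ γ` with `γ` primitive
fixes a nonzero vector kills the primitive homology
(`IsNormalCover.apply_eq_zero_of_mem_primitiveH1`). Applied to the coordinates of an isomorphism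
this gives the second claim, and applied to a retraction of an embedding, the third.
-/

open scoped MonoidAlgebra

/-! ### Modules over semisimple algebras -/

section SemisimpleModules

variable {k A : Type*} [Field k] [Ring A] [Algebra k A]

theorem finite_linearHom_over_algebra (M S : Type*) [AddCommGroup M] [Module k M] [Module A M]
    [IsScalarTower k A M] [Module.Finite k M] [AddCommGroup S] [Module k S] [Module A S]
    [IsScalarTower k A S] [Module.Finite k S] : Module.Finite k (M →ₗ[A] S) :=
  Module.Finite.of_injective
    ({ toFun := fun f => f.restrictScalars k
       map_add' := fun _ _ => rfl
       map_smul' := fun _ _ => rfl } : (M →ₗ[A] S) →ₗ[k] (M →ₗ[k] S))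
    (fun _ _ h => LinearMap.ext fun x => LinearMap.congr_fun h x)

theorem finrank_linearHom_of_prod_equiv {M P Q S : Type*} [AddCommGroup M] [Module A M]
    [AddCommGroup P] [Module A P] [AddCommGroup Q] [Module A Q] [AddCommGroup S] [Module k S]
    [Module A S] [IsScalarTower k A S] (e : (P × Q) ≃ₗ[A] M)
    [Module.Finite k (P →ₗ[A] S)] [Module.Finite k (Q →ₗ[A] S)] :
    Module.finrank k (M →ₗ[A] S)
      = Module.finrank k (P →ₗ[A] S) + Module.finrank k (Q →ₗ[A] S) := by
  rw [← Module.finrank_prod, ((LinearMap.coprodEquiv k).trans (e.congrLeft S k)).finrank_eq]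

theorem exists_equiv_of_isSimpleModule_submodule {A : Type*} [Ring A] {ι : Type*} {S : ι → Type*}
    [∀ i, AddCommGroup (S i)] [∀ i, Module A (S i)] {M : Type*} [AddCommGroup M] [Module A M]
    (R : Submodule A M)
    (hM : ∀ P : Submodule A M, IsSimpleModule A P → ∃ i, Nonempty (P ≃ₗ[A] S i))
    (T : Submodule A R) (hT : IsSimpleModule A T) : ∃ i, Nonempty (T ≃ₗ[A] S i) := by
  let t := T.equivMapOfInjective R.subtype R.injective_subtype
  obtain ⟨i, ⟨z⟩⟩ := hM (T.map R.subtype) (IsSimpleModule.congr t.symm)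
  exact ⟨i, ⟨t ≪≫ₗ z⟩⟩

/-- Over a semisimple algebra, a finite-dimensional module `M` is determined by the dimensions of
the spaces of homomorphisms from it to the simple modules. A simple submodule of `M`, isomorphic to
`S i`, is split off from both modules, and the induction is on the dimension `d` of `M`. The module
`N` need not be known to be finite-dimensional, but the homomorphism spaces do, as an
infinite-dimensional one has `finrank` zero. -/
theorem nonempty_linearEquiv_of_finrank_hom_eq [IsSemisimpleRing A] {ι : Type*} {S : ι → Type*}
    [∀ i, AddCommGroup (S i)] [∀ i, Module k (S i)] [∀ i, Module A (S i)]
    [∀ i, IsScalarTower k A (S i)] [∀ i, IsSimpleModule A (S i)] [∀ i, Module.Finite k (S i)]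
    (d : ℕ) : ∀ {M N : Type*} [AddCommGroup M] [Module k M] [Module A M] [IsScalarTower k A M]
      [Module.Finite k M] [AddCommGroup N] [Module k N] [Module A N] [IsScalarTower k A N]
      (_ : ∀ P : Submodule A M, IsSimpleModule A P → ∃ i, Nonempty (P ≃ₗ[A] S i))
      (_ : ∀ P : Submodule A N, IsSimpleModule A P → ∃ i, Nonempty (P ≃ₗ[A] S i))
      (_ : ∀ i, Module.Finite k (N →ₗ[A] S i))
      (_ : ∀ i, Module.finrank k (M →ₗ[A] S i) = Module.finrank k (N →ₗ[A] S i))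
      (_ : Module.finrank k M = d), Nonempty (M ≃ₗ[A] N) := by
  induction d using Nat.strong_induction_on with
  | _ d ih =>
  intro M N _ _ _ _ _ _ _ _ _ hM hN hfin hrank hd
  have hMfin (i : ι) : Module.Finite k (M →ₗ[A] S i) := finite_linearHom_over_algebra M (S i)
  rcases subsingleton_or_nontrivial M with hs | hnt
  · -- A simple submodule of `N` would be a quotient of `N`, contradicting `Hom(N, S i) = 0`.
    have : Subsingleton N := by
      by_contra hN'
      rw [not_subsingleton_iff_nontrivial] at hN'
      obtain ⟨P, hP⟩ := IsSemisimpleModule.exists_simple_submodule A N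
      obtain ⟨i, ⟨u⟩⟩ := hN P hP
      obtain ⟨Q, hQ⟩ := exists_isCompl P
      have h0 : Subsingleton (N →ₗ[A] S i) := by
        have := hfin i
        rw [← Module.finrank_zero_iff (R := k), ← hrank i]
        exact Module.finrank_zero_of_subsingleton
      have hz : u.toLinearMap ∘ₗ P.projectionOnto Q hQ = 0 := Subsingleton.elim _ _
      have := hP.nontrivial
      obtain ⟨p, hp⟩ := exists_ne (0 : P)
      apply hp
      have := LinearMap.congr_fun hz p
      simpa using this
    exact ⟨0, 0, fun _ => Subsingleton.elim _ _, fun _ => Subsingleton.elim _ _⟩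
  · obtain ⟨P, hP⟩ := IsSemisimpleModule.exists_simple_submodule A M
    obtain ⟨i, ⟨u⟩⟩ := hM P hP
    obtain ⟨Q, hQ⟩ := exists_isCompl P
    -- The projection onto `P ≃ S i` shows that `M`, hence also `N`, has a nonzero map to `S i`.
    have hne : (u.toLinearMap ∘ₗ P.projectionOnto Q hQ) ≠ 0 := by
      intro hz
      have := hP.nontrivial
      obtain ⟨p, hp⟩ := exists_ne (0 : P)
      apply hp
      have := LinearMap.congr_fun hz p
      simpa using this
    have hnt' : Nontrivial (N →ₗ[A] S i) := by
      have := hfin i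
      have := hMfin i
      rw [← Module.finrank_pos_iff (R := k), ← hrank i, Module.finrank_pos_iff]
      exact ⟨_, _, hne⟩
    obtain ⟨f, hf⟩ := exists_ne (0 : N →ₗ[A] S i)
    have hsurj := (LinearMap.surjective_or_eq_zero f).resolve_right hf
    obtain ⟨Q', hQ'⟩ := exists_isCompl (LinearMap.ker f)
    let v : Q' ≃ₗ[A] S i :=
      (Submodule.quotientEquivOfIsCompl _ _ hQ').symm ≪≫ₗ f.quotKerEquivOfSurjective hsurj
    let eM : (P × Q) ≃ₗ[A] M := Submodule.prodEquivOfIsCompl P Q hQ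
    let eN : (LinearMap.ker f × Q') ≃ₗ[A] N := Submodule.prodEquivOfIsCompl _ Q' hQ'
    have hfin' (j : ι) : Module.Finite k (LinearMap.ker f →ₗ[A] S j) := by
      have := hfin j
      refine Module.Finite.of_injective
        ({ toFun := fun g => g ∘ₗ LinearMap.fst A _ _ ∘ₗ eN.symm.toLinearMap
           map_add' := fun _ _ => rfl
           map_smul' := fun _ _ => rfl } : (LinearMap.ker f →ₗ[A] S j) →ₗ[k] (N →ₗ[A] S j)) ?_
      intro g g' h
      ext x
      simpa using LinearMap.congr_fun h (eN (x, 0))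
    let w : P ≃ₗ[A] Q' := u ≪≫ₗ v.symm
    have hQ'fin (j : ι) : Module.Finite k (Q' →ₗ[A] S j) :=
      have : Module.Finite k P := inferInstanceAs (Module.Finite k (P.restrictScalars k))
      have := finite_linearHom_over_algebra (k := k) (A := A) P (S j)
      Module.Finite.equiv (w.congrLeft (S j) k)
    have hPfin : Module.Finite k P := inferInstanceAs (Module.Finite k (P.restrictScalars k))
    have hQfin : Module.Finite k Q := inferInstanceAs (Module.Finite k (Q.restrictScalars k))
    have hlt : Module.finrank k Q < d := by
      have h1 := (eM.restrictScalars k).finrank_eq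
      have := hP.nontrivial
      have h2 : 0 < Module.finrank k P := Module.finrank_pos
      rw [Module.finrank_prod] at h1
      omega
    have hrank' (j : ι) : Module.finrank k (Q →ₗ[A] S j)
        = Module.finrank k (LinearMap.ker f →ₗ[A] S j) := by
      have := finite_linearHom_over_algebra (k := k) (A := A) P (S j)
      have := finite_linearHom_over_algebra (k := k) (A := A) Q (S j)
      have h1 := finrank_linearHom_of_prod_equiv (k := k) (S := S j) eM
      have h2 := finrank_linearHom_of_prod_equiv (k := k) (S := S j) eN
      have h3 := (w.congrLeft (S j) k).finrank_eq
      have h4 := hrank j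
      omega
    obtain ⟨z⟩ := ih _ hlt (exists_equiv_of_isSimpleModule_submodule Q hM)
      (exists_equiv_of_isSimpleModule_submodule (LinearMap.ker f) hN) hfin' hrank' rfl
    exact ⟨eM.symm ≪≫ₗ LinearEquiv.prodCongr w z ≪≫ₗ LinearEquiv.prodComm A _ _ ≪≫ₗ eN⟩

end SemisimpleModules

/-! ### Representations of finite groups -/

section FiniteGroupReps

open Representation

theorem Representation.IsIrreducible.of_equiv {G S T : Type*} [Group G]
    [AddCommGroup S] [Module ℂ S]
    [AddCommGroup T] [Module ℂ T]
    {τ : Representation ℂ G S} {τ' : Representation ℂ G T} (hτ : τ.IsIrreducible)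
    (e : τ.Equiv τ') : τ'.IsIrreducible := by
  rw [irreducible_iff_isSimpleModule_asModule] at hτ ⊢
  let E : τ'.asModule ≃ₗ[ℂ[G]] τ.asModule :=
    LinearEquiv.ofBijective (IntertwiningMap.equivLinearMapAsModule _ _ e.symm.toIntertwiningMap)
      e.symm.toLinearEquiv.bijective
  exact IsSimpleModule.congr E

variable {G : Type*} [Group G] [Finite G]

/-- A map that vanishes on the kernel of `f` factors through `f`: it does so on the image of `f`,
and extends from there since modules over the group algebra of a finite group are injective. -/
theorem Representation.IntertwiningMap.exists_comp_eq {M N S : Type*} [AddCommGroup M] [Module ℂ M]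
    [AddCommGroup N] [Module ℂ N] [AddCommGroup S] [Module ℂ S] {ρ : Representation ℂ G M}
    {σ : Representation ℂ G N} {τ : Representation ℂ G S} (f : IntertwiningMap ρ σ)
    (h : IntertwiningMap ρ τ) (hle : ∀ v, f v = 0 → h v = 0) :
    ∃ h' : IntertwiningMap σ τ, h'.comp f = h := by
  let F := IntertwiningMap.equivLinearMapAsModule ρ σ f
  let H := IntertwiningMap.equivLinearMapAsModule ρ τ h
  have hle' : LinearMap.ker F ≤ LinearMap.ker H := fun v hv => hle v hv
  obtain ⟨r, hr⟩ := MonoidAlgebra.exists_leftInverse_of_injective (k := ℂ)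
    (LinearMap.range F).subtype (Submodule.ker_subtype _)
  let H' := (LinearMap.ker F).liftQ H hle' ∘ₗ F.quotKerEquivRange.symm.toLinearMap ∘ₗ r
  refine ⟨(IntertwiningMap.equivLinearMapAsModule σ τ).symm H', ?_⟩
  apply (IntertwiningMap.equivLinearMapAsModule ρ τ).injective
  ext v
  change H' (F v) = H v
  have h1 : r (F v) = ⟨F v, v, rfl⟩ := LinearMap.congr_fun hr ⟨F v, v, rfl⟩
  have h2 : F.quotKerEquivRange.symm ⟨F v, v, rfl⟩ = Submodule.Quotient.mk v := by
    rw [LinearEquiv.symm_apply_eq]; rfl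
  simp only [H', LinearMap.comp_apply, h1, LinearEquiv.coe_coe, h2]
  exact Submodule.liftQ_apply _ _ _

/-- Exactness of `Hom_G(-, S)`, as an identity between dimensions for an exact sequence
`0 → M₁ → M₂ → M₃ → M₄ → 0`. -/
theorem Representation.finrank_intertwiningMap_exact {M₁ M₂ M₃ M₄ S : Type*}
    [AddCommGroup M₁] [Module ℂ M₁] [AddCommGroup M₂] [Module ℂ M₂] [AddCommGroup M₃] [Module ℂ M₃]
    [AddCommGroup M₄] [Module ℂ M₄] [AddCommGroup S] [Module ℂ S]
    [Module.Finite ℂ M₂] [Module.Finite ℂ M₃] [Module.Finite ℂ S]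
    {ρ₁ : Representation ℂ G M₁} {ρ₂ : Representation ℂ G M₂} {ρ₃ : Representation ℂ G M₃}
    {ρ₄ : Representation ℂ G M₄} (σ : Representation ℂ G S)
    (f : IntertwiningMap ρ₁ ρ₂) (g : IntertwiningMap ρ₂ ρ₃) (h : IntertwiningMap ρ₃ ρ₄)
    (hf : Function.Injective f) (hfg : Function.Exact f g) (hgh : Function.Exact g h)
    (hh : Function.Surjective h) :
    Module.finrank ℂ (IntertwiningMap ρ₁ σ) + Module.finrank ℂ (IntertwiningMap ρ₃ σ)
      = Module.finrank ℂ (IntertwiningMap ρ₂ σ) + Module.finrank ℂ (IntertwiningMap ρ₄ σ) := by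
  let a : IntertwiningMap ρ₂ σ →ₗ[ℂ] IntertwiningMap ρ₁ σ := (IntertwiningMap.llcomp ρ₁ ρ₂ σ).flip f
  let b : IntertwiningMap ρ₃ σ →ₗ[ℂ] IntertwiningMap ρ₂ σ := (IntertwiningMap.llcomp ρ₂ ρ₃ σ).flip g
  let c : IntertwiningMap ρ₄ σ →ₗ[ℂ] IntertwiningMap ρ₃ σ := (IntertwiningMap.llcomp ρ₃ ρ₄ σ).flip h
  have happ {T : IntertwiningMap ρ₂ σ} (v) : a T v = T (f v) := rfl
  have hbpp {T : IntertwiningMap ρ₃ σ} (v) : b T v = T (g v) := rfl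
  have hcpp {T : IntertwiningMap ρ₄ σ} (v) : c T v = T (h v) := rfl
  have ha : Function.Surjective a := fun T =>
    IntertwiningMap.exists_comp_eq f T fun v hv => by
      rw [hf (hv.trans (map_zero f).symm), map_zero]
  have hab : LinearMap.ker a = LinearMap.range b := by
    apply le_antisymm
    · intro T hT
      refine IntertwiningMap.exists_comp_eq g T fun v hv => ?_
      obtain ⟨u, rfl⟩ := (hfg v).1 hv
      exact DFunLike.congr_fun (LinearMap.mem_ker.1 hT) u
    · rintro _ ⟨T, rfl⟩
      refine DFunLike.ext _ _ fun v => ?_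
      rw [happ, hbpp, (hfg _).2 ⟨v, rfl⟩, map_zero]; rfl
  have hbc : LinearMap.ker b = LinearMap.range c := by
    apply le_antisymm
    · intro T hT
      refine IntertwiningMap.exists_comp_eq h T fun v hv => ?_
      obtain ⟨u, rfl⟩ := (hgh v).1 hv
      exact DFunLike.congr_fun (LinearMap.mem_ker.1 hT) u
    · rintro _ ⟨T, rfl⟩
      refine DFunLike.ext _ _ fun v => ?_
      rw [hbpp, hcpp, (hgh _).2 ⟨v, rfl⟩, map_zero]; rfl
  have hc : Function.Injective c := fun T T' hT => by
    refine DFunLike.ext _ _ fun v => ?_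
    obtain ⟨u, rfl⟩ := hh v
    exact DFunLike.congr_fun hT u
  have h1 := a.finrank_range_add_finrank_ker
  have h2 := b.finrank_range_add_finrank_ker
  have h3 := LinearMap.finrank_range_of_inj hc
  have h4 : Module.finrank ℂ (LinearMap.range a) = Module.finrank ℂ (IntertwiningMap ρ₁ σ) := by
    rw [LinearMap.range_eq_top.2 ha, finrank_top]
  rw [hab] at h1
  rw [hbc] at h2
  omega

theorem Representation.IsIrreducible.finiteDimensional {S : Type*} [AddCommGroup S] [Module ℂ S]
    {τ : Representation ℂ G S} (hτ : τ.IsIrreducible) : Module.Finite ℂ S := by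
  have : IsSimpleModule ℂ[G] τ.asModule := (irreducible_iff_isSimpleModule_asModule τ).1 hτ
  have : Module.Finite ℂ ℂ[G] := inferInstance
  have h : Module.Finite ℂ τ.asModule := Module.Finite.trans ℂ[G] _
  exact Module.Finite.equiv τ.asModuleEquiv

variable {ι : Type*} {W : ι → Type w} [∀ i, AddCommGroup (W i)] [∀ i, Module ℂ (W i)]
    {σ : ∀ i, Representation ℂ G (W i)}

/-- A family that is complete for the representations on types in one universe is complete for all
universes, because irreducible representations of a finite group are finite-dimensional and can be
moved to coordinate spaces. -/
theorem IsCompleteIrrFamily.exists_equiv (hσ : IsCompleteIrrFamily σ) {S : Type*} [AddCommGroup S]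
    [Module ℂ S] (τ : Representation ℂ G S) (hτ : τ.IsIrreducible) :
    ∃ i, Nonempty (τ.Equiv (σ i)) := by
  have := hτ.finiteDimensional
  let e : S ≃ₗ[ℂ] ULift.{w} (Fin (Module.finrank ℂ S) → ℂ) :=
    (Module.finBasis ℂ S).equivFun.trans ULift.moduleEquiv.symm
  let τ' : Representation ℂ G (ULift.{w} (Fin (Module.finrank ℂ S) → ℂ)) :=
    (e.conjAlgEquiv ℂ).toMonoidHom.comp τ
  let E : τ.Equiv τ' := .mk e fun g => by
    ext v
    simp [τ']
  obtain ⟨i, ⟨z⟩⟩ := hσ.complete _ τ' (hτ.of_equiv E)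
  exact ⟨i, ⟨E.trans z⟩⟩

theorem IsCompleteIrrFamily.exists_linearEquiv (hσ : IsCompleteIrrFamily σ) {P : Type*}
    [AddCommGroup P] [Module ℂ P] [Module ℂ[G] P] [IsScalarTower ℂ ℂ[G] P]
    [IsSimpleModule ℂ[G] P] : ∃ i, Nonempty (P ≃ₗ[ℂ[G]] (σ i).asModule) := by
  let τ : Representation ℂ G P := ofModule' P
  have hact (r : ℂ[G]) (m : P) : τ.asAlgebraHom r m = r • m :=
    LinearMap.congr_fun (DFunLike.congr_fun
      ((MonoidAlgebra.lift ℂ (P →ₗ[ℂ] P) G).apply_symm_apply (Algebra.lsmul ℂ ℂ P)) r) m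
  let E' : τ.asModule ≃ₗ[ℂ[G]] P :=
    { τ.asModuleEquiv.toAddEquiv with
      map_smul' := fun r m => hact r (τ.asModuleEquiv m) }
  have h : τ.IsIrreducible :=
    (irreducible_iff_isSimpleModule_asModule τ).2 (IsSimpleModule.congr E')
  obtain ⟨i, ⟨z⟩⟩ := hσ.exists_equiv _ h
  let E : τ.asModule ≃ₗ[ℂ[G]] (σ i).asModule :=
    LinearEquiv.ofBijective (IntertwiningMap.equivLinearMapAsModule _ _ z.toIntertwiningMap)
      z.toLinearEquiv.bijective
  exact ⟨i, ⟨E'.symm ≪≫ₗ E⟩⟩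

/-- A finite-dimensional representation of a finite group is determined by the dimensions of the
spaces of intertwining maps to the irreducible representations. -/
theorem IsCompleteIrrFamily.nonempty_equiv (hσ : IsCompleteIrrFamily σ) {M N : Type*}
    [AddCommGroup M] [Module ℂ M] [AddCommGroup N] [Module ℂ N] [Module.Finite ℂ M]
    (ρ : Representation ℂ G M) (τ : Representation ℂ G N)
    (hfin : ∀ i, Module.Finite ℂ (IntertwiningMap τ (σ i)))
    (hrank : ∀ i, Module.finrank ℂ (IntertwiningMap ρ (σ i))
      = Module.finrank ℂ (IntertwiningMap τ (σ i))) : Nonempty (ρ.Equiv τ) := by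
  have (i : ι) : IsSimpleModule ℂ[G] (σ i).asModule :=
    (irreducible_iff_isSimpleModule_asModule _).1 (hσ.irreducible i)
  have (i : ι) : Module.Finite ℂ (W i) := (hσ.irreducible i).finiteDimensional
  obtain ⟨E⟩ := nonempty_linearEquiv_of_finrank_hom_eq (k := ℂ) (A := ℂ[G])
    (S := fun i => (σ i).asModule) _ (M := ρ.asModule) (N := τ.asModule)
    (fun _ _ => hσ.exists_linearEquiv) (fun _ _ => hσ.exists_linearEquiv)
    (fun i => Module.Finite.equiv (IntertwiningMap.equivLinearMapAsModule τ (σ i)))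
    (fun i => by
      rw [← (IntertwiningMap.equivLinearMapAsModule ρ (σ i)).finrank_eq, hrank,
        (IntertwiningMap.equivLinearMapAsModule τ (σ i)).finrank_eq]) rfl
  exact ⟨((IntertwiningMap.equivLinearMapAsModule ρ τ).symm E.toLinearMap).ofBijective
    E.bijective⟩

end FiniteGroupReps

/-! ### Multiplicities in permutation modules and direct sums -/

section Multiplicities

open Representation

theorem OrientedGraph.chainRep_single {G Z : Type*} [Group G] [MulAction G Z] (g : G) (z : Z)
    (c : ℂ) : chainRep G Z g (Finsupp.single z c) = Finsupp.single (g • z) c :=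
  Finsupp.mapDomain_single

/-- The permutation module of a free `G`-set with orbit space `B` is free with basis `B`, so that
an intertwining map from it is given by arbitrary images of representatives of the orbits. -/
theorem OrientedGraph.finrank_intertwiningMap_chainRep {G Z B S : Type*} [Group G] [MulAction G Z]
    [Finite B] [AddCommGroup S] [Module ℂ S] [Module.Finite ℂ S] (σ : Representation ℂ G S)
    (p : Z → B)
    (hp : Function.Surjective p) (hsmul : ∀ (g : G) z, p (g • z) = p z)
    (htrans : ∀ z z', p z = p z' → ∃! g : G, g • z = z') :
    Module.finrank ℂ (IntertwiningMap (chainRep G Z) σ) = Nat.card B * Module.finrank ℂ S := by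
  -- `s b` represents the orbit `b`, and `t z` carries the representative of its orbit to `z`.
  choose s hs using hp
  choose t ht htu using fun z => htrans (s (p z)) z (hs _)
  have ht_smul (g : G) (z : Z) : t (g • z) = g * t z := by
    refine (htu _ _ ?_).symm
    change (g * t z) • s (p (g • z)) = g • z
    rw [hsmul, mul_smul]
    exact congrArg _ (ht z)
  have ht_s (b : B) : t (s b) = 1 := by
    refine (htu _ _ ?_).symm
    simp [hs]
  let Ψ : IntertwiningMap (chainRep G Z) σ ≃ₗ[ℂ] (B → S) :=
    { toFun := fun T b => T (Finsupp.single (s b) 1)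
      map_add' := fun _ _ => rfl
      map_smul' := fun _ _ => rfl
      invFun := fun f =>
        { toLinearMap := Finsupp.lsum ℂ fun z => LinearMap.toSpanSingleton ℂ S (σ (t z) (f (p z)))
          isIntertwining' := fun g => by
            refine Finsupp.lhom_ext fun z c => ?_
            simp [chainRep_single, ht_smul, hsmul] }
      left_inv := fun T => by
        refine IntertwiningMap.ext (Finsupp.lhom_ext fun z c => ?_)
        have h1 : σ (t z) (T (Finsupp.single (s (p z)) 1)) = T (Finsupp.single z 1) := by
          rw [← T.isIntertwining, chainRep_single]
          congr 2
          exact ht z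
        have h2 : T (Finsupp.single z c) = c • T (Finsupp.single z 1) := by
          rw [← map_smul, Finsupp.smul_single, smul_eq_mul, mul_one]
        simp [h1, h2]
      right_inv := fun f => by
        funext b
        change (Finsupp.lsum ℂ fun z => LinearMap.toSpanSingleton ℂ S (σ (t z) (f (p z))))
          (Finsupp.single (s b) 1) = f b
        simp [ht_s, hs] }
  have := Fintype.ofFinite B
  rw [Ψ.finrank_eq, Module.finrank_pi_fintype]
  simp

variable {G : Type*} [Group G] [Finite G]
variable {ι : Type*} {W : ι → Type w} [∀ i, AddCommGroup (W i)] [∀ i, Module ℂ (W i)]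
    {σ : ∀ i, Representation ℂ G (W i)}

open scoped DirectSum in
/-- The inclusion of the `m`-th copy of `σ j` into `⨁_j (σ j) ^ (k j)`. -/
noncomputable def powerInclusion [DecidableEq ι] (σ : ∀ i, Representation ℂ G (W i)) (k : ι → ℕ)
    (j : ι) (m : Fin (k j)) :
    IntertwiningMap (σ j) (directSum fun j => (σ j).finsupp (Fin (k j))) where
  toLinearMap := DirectSum.lof ℂ ι (fun j => Fin (k j) →₀ W j) j ∘ₗ Finsupp.lsingle m
  isIntertwining' g := by
    ext1 v
    simp [DirectSum.lmap_lof]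

open scoped DirectSum in
/-- The projection of `⨁_j (σ j) ^ (k j)` onto the `m`-th copy of `σ j`. -/
noncomputable def powerProjection (σ : ∀ i, Representation ℂ G (W i)) (k : ι → ℕ)
    (j : ι) (m : Fin (k j)) :
    IntertwiningMap (directSum fun j => (σ j).finsupp (Fin (k j))) (σ j) where
  toLinearMap := Finsupp.lapply m ∘ₗ DirectSum.component ℂ ι (fun j => Fin (k j) →₀ W j) j
  isIntertwining' g := by
    classical
    refine DirectSum.linearMap_ext _ fun j' => Finsupp.lhom_ext fun m' v => ?_
    by_cases hj : j' = j
    · subst hj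
      by_cases hm : m' = m
      · subst hm
        simp [DirectSum.lmap_lof, DirectSum.component.lof_self]
      · simp [DirectSum.lmap_lof, DirectSum.component.lof_self, Finsupp.single_eq_of_ne' hm]
    · simp [DirectSum.lmap_lof, DirectSum.component.of, hj]

/-- By Schur's lemma, an intertwining map from `⨁_j (σ j) ^ (k j)` to `σ i` is given by its
restrictions to the copies of `σ i`, which are arbitrary. -/
noncomputable def IsCompleteIrrFamily.intertwiningMapDirectSumEquiv (hσ : IsCompleteIrrFamily σ)
    (k : ι → ℕ) (i : ι) :
    IntertwiningMap (directSum fun j => (σ j).finsupp (Fin (k j))) (σ i) ≃ₗ[ℂ]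
      (Fin (k i) → IntertwiningMap (σ i) (σ i)) := by
  classical
  refine LinearEquiv.ofBijective
    { toFun := fun T m => T.comp (powerInclusion σ k i m)
      map_add' := fun _ _ => rfl
      map_smul' := fun _ _ => rfl } ⟨?_, ?_⟩
  · intro T T' h
    refine IntertwiningMap.ext (DirectSum.linearMap_ext _ fun j => Finsupp.lhom_ext' fun m => ?_)
    suffices T.comp (powerInclusion σ k j m) = T'.comp (powerInclusion σ k j m) from
      congrArg IntertwiningMap.toLinearMap this
    by_cases hj : j = i
    · subst hj
      exact congrFun h m
    · have := hσ.irreducible i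
      have := hσ.irreducible j
      have : IsEmpty ((σ j).Equiv (σ i)) := ⟨fun e => hj (hσ.eq_of_equiv _ _ ⟨e⟩)⟩
      exact Subsingleton.elim _ _
  · intro c
    refine ⟨∑ m, (c m).comp (powerProjection σ k i m), funext fun m => DFunLike.ext _ _ fun v => ?_⟩
    change (∑ m, (c m).comp (powerProjection σ k i m)) (powerInclusion σ k i m v) = c m v
    rw [IntertwiningMap.sum_apply]
    have h (m' : Fin (k i)) : powerProjection σ k i m' (powerInclusion σ k i m v)
        = Finsupp.single m v m' := by
      simp [powerProjection, powerInclusion, ← IntertwiningMap.toLinearMap_apply,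
        DirectSum.component.lof_self]
    simp only [IntertwiningMap.comp_apply, h]
    rw [Finset.sum_eq_single m (fun m' _ hm => by simp [Finsupp.single_eq_of_ne hm]) (by simp)]
    simp

/-- The intertwining maps from a direct sum of two representations are pairs of intertwining
maps. -/
noncomputable def Representation.IntertwiningMap.coprodEquiv {k G M N S : Type*} [Field k]
    [Monoid G]
    [AddCommGroup M] [Module k M] [AddCommGroup N] [Module k N] [AddCommGroup S] [Module k S]
    (ρ : Representation k G M) (τ : Representation k G N) (σ : Representation k G S) :
    IntertwiningMap (ρ.prod τ) σ ≃ₗ[k] IntertwiningMap ρ σ × IntertwiningMap τ σ where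
  toFun T := (T.comp (.inl k ρ τ), T.comp (.inr k ρ τ))
  map_add' _ _ := rfl
  map_smul' _ _ := rfl
  invFun p := p.1.comp (.fst k ρ τ) + p.2.comp (.snd k ρ τ)
  left_inv T := by
    refine DFunLike.ext _ _ fun v => ?_
    change T (v.1, 0) + T (0, v.2) = T v
    rw [← map_add]
    simp
  right_inv p := by
    refine Prod.ext (DFunLike.ext _ _ fun v => ?_) (DFunLike.ext _ _ fun v => ?_)
    · change p.1 v + p.2 0 = p.1 v
      simp
    · change p.1 0 + p.2 v = p.2 v
      simp

theorem IsCompleteIrrFamily.finite_intertwiningMap_chevalleyWeilRep (hσ : IsCompleteIrrFamily σ)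
    (n : ℕ) (i : ι) : Module.Finite ℂ (IntertwiningMap (chevalleyWeilRep σ n) (σ i)) := by
  have := (hσ.irreducible i).finiteDimensional
  have := Module.Finite.equiv (hσ.intertwiningMapDirectSumEquiv
    (fun j => (n - 1) * Module.finrank ℂ (W j)) i).symm
  exact Module.Finite.equiv (IntertwiningMap.coprodEquiv _ _ _).symm

theorem IsCompleteIrrFamily.finrank_intertwiningMap_chevalleyWeilRep (hσ : IsCompleteIrrFamily σ)
    (n : ℕ) (i : ι) : Module.finrank ℂ (IntertwiningMap (chevalleyWeilRep σ n) (σ i))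
      = (n - 1) * Module.finrank ℂ (W i)
        + Module.finrank ℂ (IntertwiningMap (Representation.trivial ℂ G ℂ) (σ i)) := by
  have := hσ.irreducible i
  have := (hσ.irreducible i).finiteDimensional
  have := Module.Finite.equiv (hσ.intertwiningMapDirectSumEquiv
    (fun j => (n - 1) * Module.finrank ℂ (W j)) i).symm
  rw [chevalleyWeilRep, (IntertwiningMap.coprodEquiv _ _ _).finrank_eq, Module.finrank_prod,
    (hσ.intertwiningMapDirectSumEquiv _ i).finrank_eq, Module.finrank_pi_fintype]
  simp [IsIrreducible.finrank_intertwiningMap_self]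

end Multiplicities

/-! ### Chains and cochains on connected graphs -/

namespace OrientedGraph

section Graph

variable {V E : Type*} {X : OrientedGraph V E}

theorem chain_append (L M : List (E × Bool)) : chain (L ++ M) = chain L + chain M := by
  simp [chain]

theorem IsWalk.boundary_chain {L : List (E × Bool)} {a b : V} (h : X.IsWalk a L b) :
    X.boundary (chain L) = Finsupp.single b 1 - Finsupp.single a 1 := by
  induction L generalizing a with
  | nil => cases h; simp [chain]
  | cons d L ih =>
    have h1 : chain (d :: L) = Finsupp.single d.1 (if d.2 then (1 : ℂ) else -1) + chain L := by
      simp [chain]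
    have h2 : X.boundary (Finsupp.single d.1 (if d.2 then (1 : ℂ) else -1))
        = Finsupp.single (X.dartTgt d) 1 - Finsupp.single (X.dartSrc d) 1 := by
      cases hd : d.2
      · simp [boundary, dartTgt, dartSrc, hd, Finsupp.mapDomain_single, -Finsupp.single_neg]
        rw [Finsupp.single_neg, Finsupp.single_neg]
        abel
      · simp [boundary, dartTgt, dartSrc, hd, Finsupp.mapDomain_single]
    rw [h1, map_add, ih h.2, h2, h.1]
    abel

/-- Exactness of `C₁ → C₀ → ℂ → 0` at `C₀` for a connected graph: each vertex is homologous to the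
base vertex `a`. -/
theorem Connected.exact_boundary (h : X.Connected) :
    Function.Exact X.boundary (Finsupp.linearCombination ℂ fun _ : V => (1 : ℂ)) := by
  obtain ⟨a⟩ := h.1
  intro c
  constructor
  · intro hc
    have key (c : V →₀ ℂ) :
        c - Finsupp.single a (Finsupp.linearCombination ℂ (fun _ : V => (1 : ℂ)) c)
          ∈ LinearMap.range X.boundary := by
      induction c using Finsupp.induction_linear with
      | zero => simp
      | add c d hc hd =>
        convert add_mem hc hd using 1
        rw [map_add, Finsupp.single_add]
        abel
      | single b z =>
        obtain ⟨L, hL⟩ := h.2 a b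
        refine ⟨z • chain L, ?_⟩
        rw [map_smul, hL.boundary_chain]
        simp [smul_sub]
    have := key c
    rwa [hc, Finsupp.single_zero, sub_zero] at this
  · rintro ⟨e, rfl⟩
    induction e using Finsupp.induction_linear with
    | zero => simp
    | add c d hc hd => rw [map_add, map_add, hc, hd, add_zero]
    | single e z => simp [boundary, Finsupp.mapDomain_single]

/-- A function on the edges with values in an abelian group is extended to edge paths through the
free group on the edges. For the coboundary of a function on the vertices the sum telescopes. -/
theorem IsWalk.lift_coboundary {A : Type*} [AddCommGroup A] (f : V → A) {L : List (E × Bool)}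
    {a b : V} (h : X.IsWalk a L b) :
    FreeGroup.lift (fun e => Multiplicative.ofAdd (f (X.tgt e) - f (X.src e))) (FreeGroup.mk L)
      = Multiplicative.ofAdd (f b - f a) := by
  induction L generalizing a with
  | nil => cases h; simp
  | cons d L ih =>
    have := ih h.2
    rw [FreeGroup.lift_mk] at this ⊢
    rw [List.map_cons, List.prod_cons, this, ← h.1, ← ofAdd_neg]
    cases hd : d.2 <;> simp [dartTgt, dartSrc, hd]

/-- A cochain on a connected graph that vanishes on closed paths is a coboundary. -/
theorem Connected.exists_coboundary (h : X.Connected) (a : V) {A : Type*} [AddCommGroup A]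
    (f : E → A) (hf : ∀ w ∈ X.pi1 a, FreeGroup.lift (fun e => Multiplicative.ofAdd (f e)) w = 1) :
    ∃ g : V → A, ∀ e, f e = g (X.tgt e) - g (X.src e) := by
  choose p hp using h.2 a
  refine ⟨fun v =>
      (FreeGroup.lift (fun e => Multiplicative.ofAdd (f e)) (FreeGroup.mk (p v))).toAdd,
    fun e => ?_⟩
  have h1 : X.IsWalk a (p (X.src e) ++ ((e, true) :: FreeGroup.invRev (p (X.tgt e)))) a :=
    (hp _).append ⟨rfl, (hp _).invRev⟩
  have h2 := hf _ ⟨_, h1, rfl⟩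
  have h3 : FreeGroup.mk (p (X.src e) ++ ((e, true) :: FreeGroup.invRev (p (X.tgt e))))
      = FreeGroup.mk (p (X.src e)) * FreeGroup.of e * (FreeGroup.mk (p (X.tgt e)))⁻¹ := by
    rw [FreeGroup.inv_mk, FreeGroup.of, FreeGroup.mul_mk, FreeGroup.mul_mk]
    simp
  rw [h3, map_mul, map_mul, map_inv, FreeGroup.lift_apply_of, mul_inv_eq_one] at h2
  exact (eq_sub_of_add_eq' (congrArg Multiplicative.toAdd h2))

/-- Every homomorphism from the fundamental group to an abelian group is given by a cochain: the
value on an edge is that of the closed path which runs through it, reached from and left for the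
base point along chosen paths `p`. -/
theorem Connected.exists_cochain (h : X.Connected) (a : V) {A : Type*} [AddCommGroup A]
    (c : X.pi1 a →* Multiplicative A) :
    ∃ f : E → A, ∀ w : X.pi1 a,
      FreeGroup.lift (fun e => Multiplicative.ofAdd (f e)) (w : FreeGroup E) = c w := by
  choose p hp using h.2 a
  have hloop {b : V} {L : List (E × Bool)} {b' : V} (hL : X.IsWalk b L b') :
      FreeGroup.mk (p b) * FreeGroup.mk L * (FreeGroup.mk (p b'))⁻¹ ∈ X.pi1 a :=
    ⟨p b ++ (L ++ FreeGroup.invRev (p b')), (hp b).append (hL.append (hp b').invRev), by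
      rw [FreeGroup.inv_mk, FreeGroup.mul_mk, FreeGroup.mul_mk, List.append_assoc]⟩
  let f : E → A := fun e => (c ⟨_, hloop (L := [(e, true)]) ⟨rfl, rfl⟩⟩).toAdd
  refine ⟨f, ?_⟩
  have key {b b' : V} {L : List (E × Bool)} (hL : X.IsWalk b L b') :
      FreeGroup.lift (fun e => Multiplicative.ofAdd (f e)) (FreeGroup.mk L) = c ⟨_, hloop hL⟩ := by
    induction L generalizing b with
    | nil =>
      cases hL
      refine (map_one (FreeGroup.lift _)).trans (Eq.symm ?_)
      refine (congrArg c (Subtype.ext ?_)).trans c.map_one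
      change FreeGroup.mk (p b') * 1 * (FreeGroup.mk (p b'))⁻¹ = 1
      rw [mul_one, mul_inv_cancel]
    | cons d L ih =>
      have h1 := ih hL.2
      have hd : X.IsWalk b [d] (X.dartTgt d) := ⟨hL.1, rfl⟩
      have h2 : FreeGroup.lift (fun e => Multiplicative.ofAdd (f e)) (FreeGroup.mk [d])
          = c ⟨_, hloop hd⟩ := by
        obtain ⟨x, s⟩ := d
        obtain rfl := hL.1
        cases s
        · have h3 : FreeGroup.mk [(x, false)] = (FreeGroup.of x)⁻¹ := rfl
          have h4 : (⟨_, hloop hd⟩ : X.pi1 a)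
              = ⟨_, hloop (L := [(x, true)]) ⟨rfl, rfl⟩⟩⁻¹ := by
            ext
            simp only [Subgroup.coe_inv, h3, mul_inv_rev, inv_inv, mul_assoc]
            rfl
          rw [h4, map_inv, h3, map_inv, FreeGroup.lift_apply_of]
          rfl
        · exact FreeGroup.lift_apply_of
      have h3 : (⟨_, hloop hL⟩ : X.pi1 a) = ⟨_, hloop hd⟩ * ⟨_, hloop hL.2⟩ := by
        ext
        simp only [Subgroup.coe_mul]
        rw [show d :: L = [d] ++ L from rfl, ← FreeGroup.mul_mk]
        group
      rw [h3, map_mul, ← h1, ← h2, ← map_mul, FreeGroup.mul_mk]; rfl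
  rintro ⟨_, L, hL, rfl⟩
  rw [key hL]
  have : (⟨_, hloop hL⟩ : X.pi1 a)
      = ⟨_, p a, hp a, rfl⟩ * ⟨_, L, hL, rfl⟩ * ⟨_, p a, hp a, rfl⟩⁻¹ := rfl
  -- In the abelian target the conjugation by `p a` disappears.
  rw [this, map_mul, map_mul, map_inv, mul_inv_cancel_comm]

/-- The Euler characteristic of a connected graph whose fundamental group is free of rank `n`, from
the exact sequence `0 → ℂ → ℂ^V → ℂ^E → ℂ^n → 0` in which the last map evaluates a cochain on a free
basis of the fundamental group. -/
theorem Connected.card_edges_add_one [Finite V] [Finite E] (h : X.Connected) (a : V) {n : ℕ}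
    (e : FreeGroup (Fin n) ≃* X.pi1 a) : Nat.card E + 1 = n + Nat.card V := by
  have := Fintype.ofFinite V
  have := Fintype.ofFinite E
  let δ : (V → ℂ) →ₗ[ℂ] (E → ℂ) := LinearMap.funLeft ℂ ℂ X.tgt - LinearMap.funLeft ℂ ℂ X.src
  let ev (w : FreeGroup E) : (E → ℂ) →ₗ[ℂ] ℂ :=
    { toFun := fun f => (FreeGroup.lift (fun e => Multiplicative.ofAdd (f e)) w).toAdd
      map_add' := fun f g => by
        induction w using FreeGroup.induction_on with
        | C1 => simp
        | of x => simp
        | inv_of x hx => simp [add_comm]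
        | mul x y hx hy => simp only [map_mul, toAdd_mul, hx, hy]; abel
      map_smul' := fun z f => by
        induction w using FreeGroup.induction_on with
        | C1 => simp
        | of x => simp
        | inv_of x hx => simp
        | mul x y hx hy => simp only [map_mul, toAdd_mul, hx, hy, smul_add] }
  let R : (E → ℂ) →ₗ[ℂ] (Fin n → ℂ) := LinearMap.pi fun j => ev (e (FreeGroup.of j))
  let κ : ℂ →ₗ[ℂ] (V → ℂ) := LinearMap.pi fun _ => LinearMap.id
  have hκ : Function.Injective κ := fun x y hxy => congrFun hxy a
  have hκδ : LinearMap.ker δ = LinearMap.range κ := by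
    apply le_antisymm
    · intro g hg
      refine ⟨g a, funext fun v => ?_⟩
      obtain ⟨L, hL⟩ := h.2 a v
      have h1 := hL.lift_coboundary g
      have h2 : (fun e => Multiplicative.ofAdd (g (X.tgt e) - g (X.src e))) = 1 :=
        funext fun e => congrFun (LinearMap.mem_ker.1 hg) e
      have h3 : FreeGroup.lift (1 : E → Multiplicative ℂ) = 1 := FreeGroup.ext_hom _ _ (by simp)
      rw [h2, h3, MonoidHom.one_apply] at h1
      exact (sub_eq_zero.1 (congrArg Multiplicative.toAdd h1.symm)).symm
    · rintro _ ⟨z, rfl⟩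
      ext e
      simp [δ, κ, LinearMap.funLeft_apply]
  have hδR : LinearMap.ker R = LinearMap.range δ := by
    apply le_antisymm
    · intro f hf
      obtain ⟨g, hg⟩ := h.exists_coboundary a f (fun w hw => by
        have h1 : ((FreeGroup.lift fun e => Multiplicative.ofAdd (f e)).comp (X.pi1 a).subtype).comp
            e.toMonoidHom = 1 :=
          FreeGroup.ext_hom _ _ fun j => congrArg Multiplicative.ofAdd (congrFun hf j)
        simpa using DFunLike.congr_fun h1 (e.symm ⟨w, hw⟩))
      exact ⟨g, funext fun e => (hg e).symm⟩
    · rintro _ ⟨g, rfl⟩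
      refine LinearMap.mem_ker.2 (funext fun j => ?_)
      obtain ⟨L, hL, hL'⟩ := (e (FreeGroup.of j)).2
      have := hL.lift_coboundary g
      rw [hL', sub_self] at this
      exact congrArg Multiplicative.toAdd this
  have hR : Function.Surjective R := by
    intro c
    obtain ⟨f, hf⟩ := h.exists_cochain a
      ((FreeGroup.lift fun j => Multiplicative.ofAdd (c j)).comp e.symm.toMonoidHom)
    refine ⟨f, funext fun j => ?_⟩
    have := hf (e (FreeGroup.of j))
    simp only [MonoidHom.comp_apply, MulEquiv.coe_toMonoidHom, MulEquiv.symm_apply_apply,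
      FreeGroup.lift_apply_of] at this
    exact congrArg Multiplicative.toAdd this
  have h1 := R.finrank_range_add_finrank_ker
  have h2 := δ.finrank_range_add_finrank_ker
  have h3 := LinearMap.finrank_range_of_inj hκ
  rw [LinearMap.range_eq_top.2 hR, finrank_top, hδR] at h1
  rw [hκδ, h3] at h2
  simp only [Module.finrank_fintype_fun_eq_card, Module.finrank_self, ← Nat.card_eq_fintype_card,
    Nat.card_fin] at h1 h2
  omega

end Graph
end OrientedGraph

/-! ### Lifts of edge paths and the primitive homology -/

theorem IsPrimitiveElement.map {F F' : Type*} [Group F] [Group F'] {γ : F}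
    (hγ : IsPrimitiveElement γ) (e : F ≃* F') : IsPrimitiveElement (e γ) := by
  obtain ⟨S, b, hb, hS⟩ := hγ
  refine ⟨e '' S, (b.map e).reindex (e.toEquiv.image S), ?_, γ, hS, rfl⟩
  rintro ⟨_, s, hs, rfl⟩
  have h1 : (e.toEquiv.image S).symm ⟨e s, s, hs, rfl⟩ = ⟨s, hs⟩ := by
    rw [Equiv.symm_apply_eq]; rfl
  change e (b ((e.toEquiv.image S).symm _)) = _
  rw [h1, hb]

namespace OrientedGraph

open Representation

section Covering

variable {VX EX VY EY : Type*} {Y : OrientedGraph VY EY} {X : OrientedGraph VX EX} {fV : VY → VX}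
  {fE : EY → EX}

theorem IsCovering.exists_lift_dartTgt (h : IsCovering Y X fV fE) {y : VY} {d : EX × Bool}
    (hd : X.dartSrc d = fV y) : ∃ y', fV y' = X.dartTgt d := by
  obtain ⟨e, s⟩ := d
  cases s
  · obtain ⟨e', ⟨-, rfl⟩, -⟩ := h.lift_tgt y e hd
    exact ⟨Y.src e', (h.map_src e').symm⟩
  · obtain ⟨e', ⟨-, rfl⟩, -⟩ := h.lift_src y e hd
    exact ⟨Y.tgt e', (h.map_tgt e').symm⟩

/-- Path lifting, of which only the end point matters here. -/
theorem IsCovering.exists_lift_end (h : IsCovering Y X fV fE) {L : List (EX × Bool)} {y : VY}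
    {b : VX} (hL : X.IsWalk (fV y) L b) : ∃ y', fV y' = b := by
  induction L generalizing y with
  | nil => exact ⟨y, hL⟩
  | cons d L ih =>
    obtain ⟨y', hy'⟩ := h.exists_lift_dartTgt hL.1
    have := hL.2
    rw [← hy'] at this
    exact ih this

theorem IsCovering.lift_dart_unique (h : IsCovering Y X fV fE) {d d' : EY × Bool}
    (h1 : Y.dartSrc d = Y.dartSrc d') (h2 : (fE d.1, d.2) = (fE d'.1, d'.2)) : d = d' := by
  obtain ⟨e, s⟩ := d
  obtain ⟨e', s'⟩ := d'
  obtain ⟨hE, rfl⟩ : fE e = fE e' ∧ s = s' := Prod.ext_iff.1 h2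
  cases s
  · exact Prod.ext ((h.lift_tgt (Y.tgt e') (fE e') (h.map_tgt e')).unique ⟨h1, hE⟩ ⟨rfl, rfl⟩) rfl
  · exact Prod.ext ((h.lift_src (Y.src e') (fE e') (h.map_src e')).unique ⟨h1, hE⟩ ⟨rfl, rfl⟩) rfl

theorem IsCovering.lift_unique (h : IsCovering Y X fV fE) {L M : List (EY × Bool)} {y b c : VY}
    (hL : Y.IsWalk y L b) (hM : Y.IsWalk y M c) (hLM : mapPath fE L = mapPath fE M) : L = M := by
  induction L generalizing y M with
  | nil => exact (List.map_eq_nil_iff.1 hLM.symm).symm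
  | cons d L ih =>
    cases M with
    | nil => simp [mapPath] at hLM
    | cons d' M =>
      obtain ⟨h1, h2⟩ := List.cons_eq_cons.1 hLM
      obtain rfl := h.lift_dart_unique (hL.1.trans hM.1.symm) h1
      rw [ih hL.2 hM.2 h2]

theorem IsCovering.surjective_vertices (h : IsCovering Y X fV fE) (hX : X.Connected) (y : VY) :
    Function.Surjective fV := fun x =>
  let ⟨_, hL⟩ := hX.2 (fV y) x
  h.exists_lift_end hL

theorem IsCovering.surjective_edges (h : IsCovering Y X fV fE) (hV : Function.Surjective fV) :
    Function.Surjective fE := fun e =>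
  let ⟨y, hy⟩ := hV (X.src e)
  let ⟨e', he', _⟩ := h.lift_src y e hy.symm
  ⟨e', he'.2⟩

theorem IsCovering.isWalk_mapPath (h : IsCovering Y X fV fE) {L : List (EY × Bool)} {a b : VY}
    (hL : Y.IsWalk a L b) : X.IsWalk (fV a) (mapPath fE L) (fV b) := by
  induction L generalizing a with
  | nil => exact congrArg _ hL
  | cons d L ih =>
    have h1 := ih hL.2
    obtain ⟨e, s⟩ := d
    obtain rfl := hL.1
    cases s
    · exact ⟨h.map_tgt e, (congrArg (X.IsWalk · (mapPath fE L) (fV b)) (h.map_src e)).mpr h1⟩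
    · exact ⟨h.map_src e, (congrArg (X.IsWalk · (mapPath fE L) (fV b)) (h.map_tgt e)).mpr h1⟩

theorem IsWalk.target_unique {L : List (EX × Bool)} {a b c : VX} (hb : X.IsWalk a L b)
    (hc : X.IsWalk a L c) : b = c := by
  induction L generalizing a with
  | nil => exact hb.symm.trans hc
  | cons d L ih => exact ih hb.2 hc.2

variable {G : Type*} [Group G] [MulAction G VY] [MulAction G EY]

/-- The deck group acts simply transitively on the fibres over the edges, as it does so on the
fibres over their initial vertices and an edge of a cover is determined by its image and initial
vertex. -/
theorem IsNormalCover.simply_transitive_edges (h : IsNormalCover G Y X fV fE) (e e' : EY)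
    (he : fE e = fE e') : ∃! g : G, g • e = e' := by
  have hs : fV (Y.src e) = fV (Y.src e') := by
    rw [← h.covering.map_src, ← h.covering.map_src, he]
  obtain ⟨g, hg, hu⟩ := h.simply_transitive _ _ hs
  refine ⟨g, ?_, fun g' hg' => hu g' ?_⟩
  · exact (h.covering.lift_src (Y.src e') (fE e') (h.covering.map_src e')).unique
      ⟨(h.src_smul g e).trans hg, (h.map_smul_edge g e).trans he⟩ ⟨rfl, rfl⟩
  · change g' • Y.src e = Y.src e'
    rw [← h.src_smul]
    exact congrArg _ hg'

/-- The translate of an edge path by a deck transformation. -/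
def smulPath (g : G) (L : List (EY × Bool)) : List (EY × Bool) :=
  mapPath (fun e => g • e) L

theorem IsNormalCover.isWalk_smulPath (h : IsNormalCover G Y X fV fE) (g : G)
    {L : List (EY × Bool)} {a b : VY} (hL : Y.IsWalk a L b) :
    Y.IsWalk (g • a) (smulPath g L) (g • b) := by
  induction L generalizing a with
  | nil => exact congrArg _ hL
  | cons d L ih =>
    have h1 := ih hL.2
    obtain ⟨e, s⟩ := d
    obtain rfl := hL.1
    cases s
    · exact ⟨h.tgt_smul g e, (congrArg (Y.IsWalk · (smulPath g L) (g • b)) (h.src_smul g e)).mpr h1⟩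
    · exact ⟨h.src_smul g e, (congrArg (Y.IsWalk · (smulPath g L) (g • b)) (h.tgt_smul g e)).mpr h1⟩

theorem IsNormalCover.mapPath_smulPath (h : IsNormalCover G Y X fV fE) (g : G)
    (L : List (EY × Bool)) : mapPath fE (smulPath g L) = mapPath fE L := by
  simp [smulPath, mapPath, Function.comp_def, h.map_smul_edge]

theorem chain_smulPath (g : G) (L : List (EY × Bool)) :
    chain (smulPath g L) = chainRep G EY g (chain L) := by
  induction L with
  | nil => simp [smulPath, mapPath, chain]
  | cons d L ih =>
    have h1 (d : EY × Bool) (L) : chain (d :: L)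
        = Finsupp.single d.1 (if d.2 then (1 : ℂ) else -1) + chain L := by simp [chain]
    rw [h1, map_add, chainRep_single, ← ih]
    exact h1 (g • d.1, d.2) (smulPath g L)

/-- If the lift of `l` at `y` ends at `a • y` and a power of `l` has a closed lift `L` at `y`, then
the lift of that power at `a • y` is on the one hand the translate of `L` by `a`, on the other hand
a cyclic rotation of `L`. Hence the chain of `L` is fixed by `a`. -/
theorem IsNormalCover.chainRep_chain_of_closed (h : IsNormalCover G Y X fV fE)
    {L : List (EY × Bool)} {l : List (EX × Bool)} {y : VY} {k : ℕ} (hk : 0 < k) {a : G}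
    (hL : Y.IsWalk y L y) (hl : mapPath fE L = (List.replicate k l).flatten)
    (ha : ∀ (M : List (EY × Bool)) (z : VY), Y.IsWalk y M z → mapPath fE M = l → z = a • y) :
    chainRep G EY a (chain L) = chain L := by
  obtain ⟨k, rfl⟩ := Nat.exists_eq_succ_of_ne_zero hk.ne'
  have h1 : mapPath fE L = l ++ (List.replicate k l).flatten := by
    rw [hl, List.replicate_succ, List.flatten_cons]
  obtain ⟨M, R, rfl, hM, hR⟩ := List.map_eq_append_iff.1 h1
  obtain ⟨z, hMz, hRz⟩ := hL.split
  obtain rfl := ha M z hMz hM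
  have h2 : smulPath a (M ++ R) = R ++ M := by
    refine h.covering.lift_unique (h.isWalk_smulPath a hL) (hRz.append hMz) ?_
    rw [h.mapPath_smulPath, hl, List.replicate_succ', List.flatten_append]
    simp only [mapPath, List.map_append] at hM hR ⊢
    rw [hM, hR]
    simp
  rw [← chain_smulPath, h2, chain_append, chain_append, add_comm]

/-- The primitive homology is killed by each equivariant map to a representation in which the images
under `φ` of primitive elements fix no nonzero vectors. -/
theorem IsNormalCover.apply_eq_zero_of_mem_primitiveH1 (h : IsNormalCover G Y X fV fE) {y₀ : VY}
    {F : Type*} [Group F] {e : F ≃* X.pi1 (fV y₀)} {φ : F →* G} (hφ : IsGivenBy Y X fV fE y₀ e φ)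
    {U : Type*} [AddCommGroup U] [Module ℂ U] {ρ : Representation ℂ G U}
    (hρ : ∀ γ, IsPrimitiveElement γ → ∀ u, ρ (φ γ) u = u → u = 0)
    (T : IntertwiningMap h.homologyRep ρ) {c : Y.H1} (hc : c ∈ primitiveH1 Y X fV fE (fV y₀)) :
    T c = 0 := by
  suffices primitiveH1 Y X fV fE (fV y₀) ≤ LinearMap.ker T.toLinearMap from this hc
  refine Submodule.span_le.2 ?_
  rintro c ⟨γ, l, y, L, hγ, hlx, hlγ, hy, ⟨k, hk, hL, hl, -⟩, hc⟩
  obtain ⟨g, rfl, -⟩ := h.simply_transitive y₀ y hy.symm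
  -- The elevation is moved to the base point, where `φ` describes the ends of lifts.
  let L₀ := smulPath g⁻¹ L
  have hL₀ : Y.IsWalk y₀ L₀ y₀ := by simpa using h.isWalk_smulPath g⁻¹ hL
  have hfix : chainRep G EY (φ (e.symm γ)) (chain L₀) = chain L₀ := by
    refine h.chainRep_chain_of_closed (l := l) hk hL₀ ((h.mapPath_smulPath _ _).trans hl) ?_
    intro M z hM hMl
    refine hφ (e.symm γ) M z hM (by rw [hMl, hlγ, e.apply_symm_apply]) ?_
    exact (hMl ▸ h.covering.isWalk_mapPath hM).target_unique hlx
  have hc₀ : (h.homologyRep g⁻¹ c : EY →₀ ℂ) = chain L₀ := by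
    rw [chain_smulPath, ← hc]; rfl
  have h0 : T (h.homologyRep g⁻¹ c) = 0 := by
    refine hρ _ (hγ.map e.symm) _ ?_
    rw [← T.isIntertwining]
    congr 1
    ext1
    change chainRep G EY _ (h.homologyRep g⁻¹ c : EY →₀ ℂ) = _
    rw [hc₀, hfix]
  have h1 : c = h.homologyRep g (h.homologyRep g⁻¹ c) := by simp
  change T c = 0
  rw [h1, T.isIntertwining, h0, map_zero]

end Covering
end OrientedGraph

/-! ### The homology of a normal cover -/

section ChevalleyWeil

open Representation OrientedGraph

variable {G VX EX VY EY : Type*} [Group G] [Finite G] [MulAction G VY] [MulAction G EY]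
  {X : OrientedGraph VX EX} {Y : OrientedGraph VY EY} {fV : VY → VX} {fE : EY → EX}

/-- The multiplicities in the exact sequence `0 → H₁(Y) → C₁(Y) → C₀(Y) → ℂ → 0` of representations,
in which the chain modules are free over the group algebra. -/
theorem OrientedGraph.IsNormalCover.finrank_intertwiningMap_homologyRep [Finite VX] [Finite EX]
    [Finite VY] [Finite EY] (h : IsNormalCover G Y X fV fE) {S : Type*} [AddCommGroup S]
    [Module ℂ S] [Module.Finite ℂ S] (σ : Representation ℂ G S) :
    Module.finrank ℂ (IntertwiningMap h.homologyRep σ) + Nat.card VX * Module.finrank ℂ S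
      = Nat.card EX * Module.finrank ℂ S
        + Module.finrank ℂ (IntertwiningMap (Representation.trivial ℂ G ℂ) σ) := by
  obtain ⟨y⟩ := h.connected_total.1
  have hV : Function.Surjective fV := h.covering.surjective_vertices h.connected_base y
  have hE : Function.Surjective fE := h.covering.surjective_edges hV
  rw [← finrank_intertwiningMap_chainRep σ fV hV h.map_smul_vertex h.simply_transitive,
    ← finrank_intertwiningMap_chainRep σ fE hE h.map_smul_edge h.simply_transitive_edges]
  let f : IntertwiningMap h.homologyRep (chainRep G EY) :=
    { toLinearMap := Y.H1.subtype
      isIntertwining' := fun g => rfl }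
  let d : IntertwiningMap (chainRep G EY) (chainRep G VY) :=
    { toLinearMap := Y.boundary
      isIntertwining' := fun g => Finsupp.lhom_ext fun e c => by
        simp [boundary, chainRep, h.src_smul, h.tgt_smul, map_sub, Finsupp.mapDomain_single] }
  let ε : IntertwiningMap (chainRep G VY) (Representation.trivial ℂ G ℂ) :=
    { toLinearMap := Finsupp.linearCombination ℂ fun _ : VY => (1 : ℂ)
      isIntertwining' := fun g => Finsupp.lhom_ext fun v c => by
        simp [chainRep_single] }
  have hf : Function.Injective f := Y.H1.injective_subtype
  have hfd : Function.Exact f d := fun c =>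
    ⟨fun hc => ⟨⟨c, hc⟩, rfl⟩, by rintro ⟨c, rfl⟩; exact c.2⟩
  have hdε : Function.Exact d ε := h.connected_total.exact_boundary
  have hε : Function.Surjective ε := fun z => by
    refine ⟨Finsupp.single y z, ?_⟩
    change Finsupp.linearCombination ℂ (fun _ : VY => (1 : ℂ)) (Finsupp.single y z) = z
    simp
  exact finrank_intertwiningMap_exact (M₁ := Y.H1) σ f d ε hf hfd hdε hε

/-- The Chevalley–Weil theorem for graphs. -/
theorem OrientedGraph.IsNormalCover.nonempty_equiv_chevalleyWeilRep [Finite VX] [Finite EX]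
    [Finite VY] [Finite EY] (h : IsNormalCover G Y X fV fE) (x₀ : VX) {n : ℕ} (hn : 1 ≤ n)
    (e : FreeGroup (Fin n) ≃* X.pi1 x₀) {ι : Type*} {W : ι → Type w}
    [∀ i, AddCommGroup (W i)] [∀ i, Module ℂ (W i)] {σ : ∀ i, Representation ℂ G (W i)}
    (hσ : IsCompleteIrrFamily σ) : Nonempty (h.homologyRep.Equiv (chevalleyWeilRep σ n)) := by
  refine hσ.nonempty_equiv (M := Y.H1) h.homologyRep (chevalleyWeilRep σ n)
    (hσ.finite_intertwiningMap_chevalleyWeilRep n) fun i => ?_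
  have : Module.Finite ℂ (W i) := (hσ.irreducible i).finiteDimensional
  have h1 := h.finrank_intertwiningMap_homologyRep (σ i)
  have h2 : Nat.card EX = (n - 1) + Nat.card VX := by
    have := h.connected_base.card_edges_add_one x₀ e
    omega
  rw [hσ.finrank_intertwiningMap_chevalleyWeilRep]
  rw [h2, add_mul] at h1
  omega

end ChevalleyWeil

theorem theorem1p3 {G VX EX VY EY : Type*} [Group G] [Finite G] [MulAction G VY] [MulAction G EY]
    [Finite VX] [Finite EX] [Finite VY] [Finite EY]
    (X : OrientedGraph VX EX) (Y : OrientedGraph VY EY) (fV : VY → VX) (fE : EY → EX)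
    (h : OrientedGraph.IsNormalCover G Y X fV fE) (y₀ : VY)
    (n : ℕ) (hn : 2 ≤ n) (e : FreeGroup (Fin n) ≃* X.pi1 (fV y₀))
    (φ : FreeGroup (Fin n) →* G) (hφ : OrientedGraph.IsGivenBy Y X fV fE y₀ e φ)
    {ι : Type*} {W : ι → Type w} [∀ i, AddCommGroup (W i)] [∀ i, Module ℂ (W i)]
    (σ : ∀ i, Representation ℂ G (W i)) (hσ : IsCompleteIrrFamily σ) :
    -- `H₁(Y; ℂ)` is isomorphic to `⨁_V V ^ ((n - 1) dim V) ⊕ ℂ`, and every isomorphism maps the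
    -- primitive homology into the sum of the summands with `V ∈ Irr^pr(φ, G)` and `ℂ`
    (Nonempty (h.homologyRep.Equiv (chevalleyWeilRep σ n)) ∧
      ∀ Φ : h.homologyRep.Equiv (chevalleyWeilRep σ n),
        ∀ c ∈ OrientedGraph.primitiveH1 Y X fV fE (fV y₀),
          ∀ i, ¬ IsIrrPr φ (σ i) → (Φ c).1 i = 0) ∧
    -- an irreducible representation that occurs in the primitive homology is in `Irr^pr(φ, G)`
    (∀ (U : Type w) [AddCommGroup U] [Module ℂ U] (ρ : Representation ℂ G U), ρ.IsIrreducible →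
      (∃ T : ρ.IntertwiningMap h.homologyRep, Function.Injective T ∧
        ∀ u, T u ∈ OrientedGraph.primitiveH1 Y X fV fE (fV y₀)) →
      ∃ γ : FreeGroup (Fin n), IsPrimitiveElement γ ∧ ∃ v : U, v ≠ 0 ∧ ρ (φ γ) v = v) := by
  have hkill {i : ι} (hi : ¬ IsIrrPr φ (σ i)) (γ : FreeGroup (Fin n)) (hγ : IsPrimitiveElement γ)
      (u : W i) (hu : σ i (φ γ) u = u) : u = 0 := by
    by_contra hu0
    exact hi ⟨hσ.irreducible i, γ, hγ, u, hu0, hu⟩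
  refine ⟨⟨h.nonempty_equiv_chevalleyWeilRep (fV y₀) (by omega) e hσ, fun Φ c hc i hi => ?_⟩, ?_⟩
  · ext m
    exact h.apply_eq_zero_of_mem_primitiveH1 hφ (hkill hi)
      (((powerProjection σ _ i m).comp (.fst ℂ _ _)).comp Φ.toIntertwiningMap) hc
  · intro U _ _ ρ hρ ⟨T, hT, hprim⟩
    by_contra hcon
    -- A complement of the image of `T` gives an equivariant retraction of `T`.
    have hker (v : U) (hv : T v = 0) : v = 0 := hT (hv.trans (map_zero T).symm)
    obtain ⟨P, hP⟩ := Representation.IntertwiningMap.exists_comp_eq (N := Y.H1) T (.id ρ) hker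
    have hzero (u : U) : u = 0 := by
      have h1 : P (T u) = u := DFunLike.congr_fun hP u
      rw [← h1]
      exact h.apply_eq_zero_of_mem_primitiveH1 hφ
        (fun γ hγ u hu => by_contra fun hu0 => hcon ⟨γ, hγ, u, hu0, hu⟩) P (hprim u)
    obtain ⟨a, b, hab⟩ := hρ.exists_pair_ne
    refine hab (SetLike.ext fun u => ?_)
    rw [hzero u]
    exact iff_of_true (zero_mem a.toSubmodule) (zero_mem b.toSubmodule)
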